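/- Let $0<p<q\le 1$, $0\le\eta<1$, $\tau\ge 0$ and $\kappa,\xi\in\mathbb N_0=\{0,1,2,\dots\}$. For $\nu\ge 1$ let $[\nu]_{p,q}=p^{\nu-1}+p^{\nu-2}q+\cdots+q^{\nu-1}$, and let $\Omega=\{z\in\mathbb C:|z|<1\}$. Assume that $1+([2]_{p,q}-1)\tau>0$ (this is automatic if $\tau\le 1$ or $p+q\ge 1$). For $\varphi$ analytic in $\Omega$ let $\mathbf D_{p,q}\varphi(z)=\dfrac{\varphi(pz)-\varphi(qz)}{(p-q)z}$ for $z\ne0$ and $\mathbf D_{p,q}\varphi(0)=\varphi'(0)$. Put $\Psi^0\varphi=\varphi$, $\Psi^{k+1}\varphi(z)=z\,\mathbf D_{p,q}(\Psi^{k}\varphi)(z)$, and $\Upsilon^{0,k}\varphi=\Psi^{k}\varphi$, $\Upsilon^{n+1,k}\varphi(z)=(1-\tau)\Upsilon^{n,k}\varphi(z)+\tau z\,(\Upsilon^{n,k}\varphi)'(z)$ for $k,n\in\mathbb N_0$. Let $\mathcal P_{p,q}^{\xi,\kappa}(\tau,\eta)$ be the class of all analytic functions on $\Omega$ of the form $\varphi(z)=z-\sum_{\nu=2}^\infty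 c_\nu z^\nu$ with all $c_\nu\ge 0$ such that $$\operatorname{Re}\left\{\frac{(1-\tau)z(\Upsilon^{\xi,\kappa}\varphi)'(z)+\tau z(\Upsilon^{\xi,\kappa+1}\varphi)'(z)}{(1-\tau)\Upsilon^{\xi,\kappa}\varphi(z)+\tau\Upsilon^{\xi,\kappa+1}\varphi(z)}\right\}>\eta\qquad(z\in\Omega),$$ where the denominator is required not to vanish for $z\neq0$, and the quotient is given its limit $1$ at $z=0$. Suppose that the sequence $$[\nu]_{p,q}^{\kappa}\,(\nu-\eta)\,\{1+([\nu]_{p,q}-1)\tau\}\,[1+(\nu-1)\tau]^{\xi}\qquad(\nu=2,3,\dots)$$ is nondecreasing. If $\varphi\in\mathcal P_{p,q}^{\xi,\kappa}(\tau,\eta)$, then $$\int_0^{2\pi}|\varphi(re^{i\theta})|^{\gamma}\,d\theta\le\int_0^{2\pi}|\varphi_*(re^{i\theta})|^{\gamma}\,d\theta\qquad\text{for all }0<r<1\text{ and }\gamma>0,$$ where $$\varphi_*(z)=z-\frac{1-\eta}{[2]_{p,q}^{\kappa}(2-\eta)\{1+([2]_{p,q}-1)\tau\}(1+\tau)^{\xi}}\,z^2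 .$$ -/

import Mathlib

namespace PQStarlike

noncomputable section

/-- The open unit disk `Ω`. -/
def unitDisk : Set ℂ := Metric.ball (0 : ℂ) 1

/-- The twin-basic number `[ν]_{p,q} = p^(ν-1) + p^(ν-2) q + ⋯ + p q^(ν-2) + q^(ν-1)`. -/
def bracket (p q : ℝ) (ν : ℕ) : ℝ :=
  ∑ i ∈ Finset.range ν, p ^ (ν - 1 - i) * q ^ i

/-- The Jackson `(p,q)`-derivative. -/
def jacksonDeriv (p q : ℝ) (φ : ℂ → ℂ) (z : ℂ) : ℂ :=
  if z = 0 then deriv φ 0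
  else (φ ((p : ℂ) * z) - φ ((q : ℂ) * z)) / (((p : ℂ) - (q : ℂ)) * z)

/-- The Salagean `(p,q)`-differential operator `Ψ_{p,q}^κ`. -/
def Psi (p q : ℝ) : ℕ → (ℂ → ℂ) → ℂ → ℂ
  | 0, φ => φ
  | κ + 1, φ => fun z => z * jacksonDeriv p q (Psi p q κ φ) z

/-- The differential operator `Υ_{τ,p,q}^{ξ,κ}`, by recursion on `ξ`. -/
def Upsilon (τ p q : ℝ) : ℕ → ℕ → (ℂ → ℂ) → ℂ → ℂ
  | 0, κ, φ => Psi p q κ φ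
  | ξ + 1, κ, φ => fun z =>
      (1 - (τ : ℂ)) * Upsilon τ p q ξ κ φ z
        + (τ : ℂ) * z * deriv (Upsilon τ p q ξ κ φ) z

/-- The class `𝒜` of normalized analytic functions on the unit disk. -/
def classA : Set (ℂ → ℂ) :=
  {φ | AnalyticOnNhd ℂ φ unitDisk ∧ φ 0 = 0 ∧ deriv φ 0 = 1}

/-- The numerator of the quotient that defines the class `𝒬`. -/
def numQ (p q τ : ℝ) (ξ κ : ℕ) (φ : ℂ → ℂ) (z : ℂ) : ℂ :=
  (1 - (τ : ℂ)) * z * deriv (Upsilon τ p q ξ κ φ) z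
    + (τ : ℂ) * z * deriv (Upsilon τ p q ξ (κ + 1) φ) z

/-- The denominator of the quotient that defines the class `𝒬`. -/
def denQ (p q τ : ℝ) (ξ κ : ℕ) (φ : ℂ → ℂ) (z : ℂ) : ℂ :=
  (1 - (τ : ℂ)) * Upsilon τ p q ξ κ φ z + (τ : ℂ) * Upsilon τ p q ξ (κ + 1) φ z

/-- The class `𝒬_{p,q}^{ξ,κ}(τ, η)`. At `z = 0` the quotient is `0 / 0`, a removable singularity
with value `1 > η`, so the condition is imposed at the other points of the disk. -/
def classQ (p q : ℝ) (ξ κ : ℕ) (τ η : ℝ) : Set (ℂ → ℂ) :=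
  {φ | φ ∈ classA ∧ ∀ z ∈ unitDisk, z ≠ 0 →
    denQ p q τ ξ κ φ z ≠ 0 ∧ η < (numQ p q τ ξ κ φ z / denQ p q τ ξ κ φ z).re}

/-- The class `𝒯` of the `φ ∈ 𝒜` with `φ(z) = z - ∑_{ν ≥ 2} c_ν z^ν` on the disk, all `c_ν ≥ 0`. -/
def classT : Set (ℂ → ℂ) :=
  {φ | φ ∈ classA ∧ ∃ c : ℕ → ℝ, (∀ ν, 2 ≤ ν → 0 ≤ c ν) ∧
    ∀ z ∈ unitDisk, HasSum (fun n : ℕ => (c (n + 2) : ℂ) * z ^ (n + 2)) (z - φ z)}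

/-- The class `𝒫_{p,q}^{ξ,κ}(τ, η)`. -/
def classP (p q : ℝ) (ξ κ : ℕ) (τ η : ℝ) : Set (ℂ → ℂ) :=
  classQ p q ξ κ τ η ∩ classT

/-- The weights `[ν]^κ (ν - η) {1 + ([ν] - 1) τ} [1 + (ν - 1) τ]^ξ`. -/
def weight (p q : ℝ) (ξ κ : ℕ) (τ η : ℝ) (ν : ℕ) : ℝ :=
  bracket p q ν ^ κ * ((ν : ℝ) - η) * (1 + (bracket p q ν - 1) * τ)
    * (1 + ((ν : ℝ) - 1) * τ) ^ ξ

/-- The function `φ_*`. -/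
def extremal (p q : ℝ) (ξ κ : ℕ) (τ η : ℝ) (z : ℂ) : ℂ :=
  z - (((1 - η) / (bracket p q 2 ^ κ * (2 - η) * (1 + (bracket p q 2 - 1) * τ)
    * (1 + τ) ^ ξ) : ℝ) : ℂ) * z ^ 2

end

end PQStarlike

open Filter Topology Complex Metric

namespace PQStarlike

/-! Write `a` for the absolute value of the `z²` coefficient of the extremal function, which is then
`z (1 - a z)`. The operators act on Taylor coefficients as multipliers. Letting `z = x → 1⁻` along
the reals in the defining inequality therefore bounds the weighted sum of the `c_ν` by `1 - η`
(`sum_weight_mul_le`). As the weights increase, `∑ c_ν ≤ a`, so `φ z = z (1 - a w z)` with `|w z| ≤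
|z|` (`exists_isSchwarzMap`).

It remains to compare `|1 - a w|^γ` with `|1 - a z|^γ` on `|z| = r`, which is Littlewood
subordination (`IsSchwarzMap.integral_rpow_le`). For `a r < 1` the function `(1 - a z)^(γ/2)` is
holomorphic on a larger disk and the mean-square inequality applies; `a r = 1` is a limit. For `a r
> 1` the function `1 - a z` has a zero inside the circle; reflecting this zero in the circle keeps
the modulus on the circle, does not decrease it inside, and leads back to the previous case. -/

/-! ### Subordination in the mean square -/

/-- A self-map of the disk of radius `r` which fixes the centre, continuous up to the boundary. -/
structure IsSchwarzMap (r : ℝ) (w : ℂ → ℂ) : Prop where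
  diffContOnCl : DiffContOnCl ℂ w (ball 0 r)
  map_zero : w 0 = 0
  norm_le : ∀ z ∈ sphere (0 : ℂ) r, ‖w z‖ ≤ r

theorem isSchwarzMap_id (r : ℝ) : IsSchwarzMap r (fun z => z) where
  diffContOnCl := differentiable_id.diffContOnCl
  map_zero := rfl
  norm_le z hz := by simpa using (mem_sphere_zero_iff_norm.1 hz).le

namespace IsSchwarzMap

variable {r : ℝ} {w : ℂ → ℂ}

theorem norm_circleMap_le (hr : 0 ≤ r) (hw : IsSchwarzMap r w) (θ : ℝ) :
    ‖w (circleMap 0 r θ)‖ ≤ r :=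
  hw.norm_le _ (circleMap_mem_sphere 0 hr θ)

theorem continuous_comp_circleMap (hr : 0 < r) (hw : IsSchwarzMap r w) :
    Continuous fun θ : ℝ => w (circleMap 0 r θ) := by
  have h := hw.diffContOnCl.continuousOn
  rw [closure_ball _ hr.ne'] at h
  exact h.comp_continuous (continuous_circleMap 0 r)
    fun θ => sphere_subset_closedBall (circleMap_mem_sphere 0 hr.le θ)

theorem integral_eval (hr : 0 < r) (hw : IsSchwarzMap r w) (P : Polynomial ℂ) :
    ∫ θ in (0 : ℝ)..(2 * Real.pi), P.eval (w (circleMap 0 r θ))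
      = (2 * Real.pi : ℂ) * P.coeff 0 := by
  have h : DiffContOnCl ℂ (fun z => P.eval (w z)) (ball 0 |r|) := by
    rw [abs_of_pos hr]
    exact P.differentiable.comp_diffContOnCl hw.diffContOnCl
  have h2 := h.circleAverage
  rw [Real.circleAverage_def, hw.map_zero, ← Polynomial.coeff_zero_eq_eval_zero] at h2
  rw [← h2, Complex.real_smul]
  push_cast
  field_simp

theorem integral_sq_eval_add_C (hr : 0 < r) (hw : IsSchwarzMap r w) (P : Polynomial ℂ)
    (hP : P.coeff 0 = 0) (a : ℂ) :
    ∫ θ in (0 : ℝ)..(2 * Real.pi), ‖(P + Polynomial.C a).eval (w (circleMap 0 r θ))‖ ^ 2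
      = (∫ θ in (0 : ℝ)..(2 * Real.pi), ‖P.eval (w (circleMap 0 r θ))‖ ^ 2)
        + 2 * Real.pi * ‖a‖ ^ 2 := by
  have hc : Continuous fun θ : ℝ => P.eval (w (circleMap 0 r θ)) :=
    P.continuous.comp (hw.continuous_comp_circleMap hr)
  -- Constants are orthogonal to `P ∘ w`: the mean of a holomorphic function is its value at the
  -- centre, here `P 0 = 0`.
  have h0 : ∫ θ in (0 : ℝ)..(2 * Real.pi), 2 * (P.eval (w (circleMap 0 r θ)) * star a).re = 0 := by
    have h1 := hw.integral_eval hr (P * Polynomial.C (star a))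
    simp only [Polynomial.eval_mul, Polynomial.eval_C, Polynomial.mul_coeff_zero, hP, zero_mul,
      mul_zero] at h1
    rw [intervalIntegral.integral_const_mul]
    have h2 := Complex.reCLM.intervalIntegral_comp_comm (a := 0) (b := 2 * Real.pi)
      ((hc.mul continuous_const).intervalIntegrable
        (μ := MeasureTheory.volume) (u := fun θ => P.eval (w (circleMap 0 r θ)) * star a) 0
        (2 * Real.pi))
    simp only [Complex.reCLM_apply] at h2
    rw [h2, h1]
    simp
  have hpt : ∀ θ : ℝ, ‖(P + Polynomial.C a).eval (w (circleMap 0 r θ))‖ ^ 2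
      = ‖P.eval (w (circleMap 0 r θ))‖ ^ 2
        + 2 * (P.eval (w (circleMap 0 r θ)) * star a).re + ‖a‖ ^ 2 := by
    intro θ
    rw [Polynomial.eval_add, Polynomial.eval_C]
    simp only [← Complex.normSq_eq_norm_sq, Complex.normSq_add]
    simp
    ring
  simp_rw [hpt]
  have hi1 : Continuous fun θ : ℝ => ‖P.eval (w (circleMap 0 r θ))‖ ^ 2 := hc.norm.pow 2
  have hi2 : Continuous fun θ : ℝ => 2 * (P.eval (w (circleMap 0 r θ)) * star a).re :=
    continuous_const.mul (Complex.continuous_re.comp (hc.mul continuous_const))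
  rw [intervalIntegral.integral_add ((hi1.fun_add hi2).intervalIntegrable _ _) (by simp),
    intervalIntegral.integral_add (hi1.intervalIntegrable _ _) (hi2.intervalIntegrable _ _), h0]
  simp

/-- Littlewood's subordination inequality in the mean square, for polynomials. -/
theorem integral_sq_eval_le (hr : 0 < r) (hw : IsSchwarzMap r w) (P : Polynomial ℂ) :
    ∫ θ in (0 : ℝ)..(2 * Real.pi), ‖P.eval (w (circleMap 0 r θ))‖ ^ 2
      ≤ ∫ θ in (0 : ℝ)..(2 * Real.pi), ‖P.eval (circleMap 0 r θ)‖ ^ 2 := by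
  induction P using Polynomial.recOnHorner with
  | M0 => simp
  -- A constant adds the same amount to both sides; in the `MX` case the extra factor `w` has
  -- modulus at most `r`, while `z` has modulus exactly `r`.
  | MC P a hP _ ih =>
    rw [hw.integral_sq_eval_add_C hr P hP a, (isSchwarzMap_id r).integral_sq_eval_add_C hr P hP a]
    linarith
  | MX P _ ih =>
    have hc : Continuous fun θ : ℝ => P.eval (w (circleMap 0 r θ)) :=
      P.continuous.comp (hw.continuous_comp_circleMap hr)
    calc
      ∫ θ in (0 : ℝ)..(2 * Real.pi), ‖(P * Polynomial.X).eval (w (circleMap 0 r θ))‖ ^ 2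
        ≤ ∫ θ in (0 : ℝ)..(2 * Real.pi), r ^ 2 * ‖P.eval (w (circleMap 0 r θ))‖ ^ 2 := by
          apply intervalIntegral.integral_mono_on Real.two_pi_pos.le
          · apply Continuous.intervalIntegrable
            simp only [Polynomial.eval_mul, Polynomial.eval_X]
            exact (hc.mul (hw.continuous_comp_circleMap hr)).norm.pow 2
          · exact (continuous_const.mul (hc.norm.pow 2)).intervalIntegrable _ _
          · intro θ _
            rw [Polynomial.eval_mul, Polynomial.eval_X, norm_mul, mul_pow, mul_comm]
            gcongr
            exact hw.norm_circleMap_le hr.le θ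
      _ ≤ r ^ 2 * ∫ θ in (0 : ℝ)..(2 * Real.pi), ‖P.eval (circleMap 0 r θ)‖ ^ 2 := by
          rw [intervalIntegral.integral_const_mul]
          gcongr
      _ = _ := by
          rw [← intervalIntegral.integral_const_mul]
          congr 1
          ext θ
          rw [Polynomial.eval_mul, Polynomial.eval_X, norm_mul, mul_pow, norm_circleMap_zero,
            sq_abs, mul_comm]

/-- Passes from polynomials to their uniform limits. The margin `r < s` puts the values of `w` on
the circle, which may have modulus `r`, inside the open ball of convergence. -/
theorem tendsto_integral_sq_eval (hr : 0 < r) (hw : IsSchwarzMap r w) {s : ℝ} (hrs : r < s)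
    {f : ℂ → ℂ} (hf : ContinuousOn f (closedBall 0 r)) {Q : ℕ → Polynomial ℂ}
    (hQ : TendstoUniformlyOn (fun n z => (Q n).eval z) f atTop (ball 0 s)) :
    Tendsto (fun n => ∫ θ in (0 : ℝ)..(2 * Real.pi), ‖(Q n).eval (w (circleMap 0 r θ))‖ ^ 2) atTop
      (𝓝 (∫ θ in (0 : ℝ)..(2 * Real.pi), ‖f (w (circleMap 0 r θ))‖ ^ 2)) := by
  have hmem : ∀ θ, w (circleMap 0 r θ) ∈ ball (0 : ℂ) s := fun θ =>
    mem_ball_zero_iff.2 ((hw.norm_circleMap_le hr.le θ).trans_lt hrs)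
  obtain ⟨C, hC⟩ := (isCompact_closedBall (0 : ℂ) r).exists_bound_of_continuousOn hf
  have hev := (Metric.tendstoUniformlyOn_iff.1 hQ) 1 one_pos
  apply intervalIntegral.tendsto_integral_filter_of_dominated_convergence (fun _ => (C + 1) ^ 2)
  · refine Eventually.of_forall fun n => Continuous.aestronglyMeasurable ?_
    exact ((Q n).continuous.comp (hw.continuous_comp_circleMap hr)).norm.pow 2
  · filter_upwards [hev] with n hn
    refine Eventually.of_forall fun θ _ => ?_
    have h1 := hn _ (hmem θ)
    have h2 := hC _ (mem_closedBall_zero_iff.2 (hw.norm_circleMap_le hr.le θ))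
    rw [dist_comm, dist_eq_norm] at h1
    have h3 := norm_le_norm_add_norm_sub' ((Q n).eval (w (circleMap 0 r θ)))
      (f (w (circleMap 0 r θ)))
    rw [Real.norm_of_nonneg (by positivity)]
    gcongr
    linarith
  · simp
  · exact Eventually.of_forall fun θ _ => ((hQ.tendsto_at (hmem θ)).norm).pow 2

end IsSchwarzMap

theorem exists_polynomial_tendstoUniformlyOn_ball {s R : ℝ} (hs : 0 ≤ s) (hsR : s < R)
    {f : ℂ → ℂ} (hf : DifferentiableOn ℂ f (closedBall 0 R)) :
    ∃ Q : ℕ → Polynomial ℂ,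
      TendstoUniformlyOn (fun n z => (Q n).eval z) f atTop (ball 0 s) := by
  lift R to NNReal using (hs.trans_lt hsR).le
  lift s to NNReal using hs
  have hps := hf.hasFPowerSeriesOnBall (lt_of_le_of_lt (zero_le (a := s)) (by exact_mod_cast hsR))
  generalize cauchyPowerSeries f 0 R = p at hps
  refine ⟨fun n => ∑ k ∈ Finset.range n, Polynomial.C (p.coeff k) * Polynomial.X ^ k, ?_⟩
  refine (hps.tendstoUniformlyOn' (r' := s) (by exact_mod_cast hsR)).congr ?_
  refine Eventually.of_forall fun n z _ => ?_
  simp only [FormalMultilinearSeries.partialSum, Polynomial.eval_finsetSum, Polynomial.eval_mul,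
    Polynomial.eval_C, Polynomial.eval_pow, Polynomial.eval_X, sub_zero]
  refine Finset.sum_congr rfl fun k _ => ?_
  rw [FormalMultilinearSeries.apply_eq_pow_smul_coeff, smul_eq_mul, mul_comm]

namespace IsSchwarzMap

variable {r : ℝ} {w : ℂ → ℂ}

/-- Littlewood's subordination inequality in the mean square. -/
theorem integral_sq_le (hr : 0 < r) (hw : IsSchwarzMap r w) {R : ℝ} (hrR : r < R) {f : ℂ → ℂ}
    (hf : DifferentiableOn ℂ f (closedBall 0 R)) :
    ∫ θ in (0 : ℝ)..(2 * Real.pi), ‖f (w (circleMap 0 r θ))‖ ^ 2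
      ≤ ∫ θ in (0 : ℝ)..(2 * Real.pi), ‖f (circleMap 0 r θ)‖ ^ 2 := by
  obtain ⟨s, hrs, hsR⟩ := exists_between hrR
  obtain ⟨Q, hQ⟩ := exists_polynomial_tendstoUniformlyOn_ball (hr.trans hrs).le hsR hf
  have hfc : ContinuousOn f (closedBall 0 r) :=
    hf.continuousOn.mono (closedBall_subset_closedBall hrR.le)
  exact le_of_tendsto_of_tendsto' (hw.tendsto_integral_sq_eval hr hrs hfc hQ)
    ((isSchwarzMap_id r).tendsto_integral_sq_eval hr hrs hfc hQ)
    fun n => hw.integral_sq_eval_le hr (Q n)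

/-! ### Subordination for powers of a linear factor -/

theorem integral_rpow_le_of_mul_lt_one (hr : 0 < r) (hw : IsSchwarzMap r w) {b : ℝ} (hb : 0 ≤ b)
    (hbr : b * r < 1) (γ : ℝ) :
    ∫ θ in (0 : ℝ)..(2 * Real.pi), ‖1 - (b : ℂ) * w (circleMap 0 r θ)‖ ^ γ
      ≤ ∫ θ in (0 : ℝ)..(2 * Real.pi), ‖1 - (b : ℂ) * circleMap 0 r θ‖ ^ γ := by
  -- On the larger disk `1 - b z` stays off the branch cut, so its power `γ / 2` is holomorphic
  -- there.
  obtain ⟨R, hrR, hbR⟩ : ∃ R, r < R ∧ b * R < 1 := by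
    rcases hb.eq_or_lt with rfl | hb
    · exact ⟨r + 1, by linarith, by simp⟩
    · obtain ⟨R, h1, h2⟩ := exists_between ((lt_div_iff₀' hb).2 hbr)
      exact ⟨R, h1, (lt_div_iff₀' hb).1 h2⟩
  have hslit : ∀ z ∈ closedBall (0 : ℂ) R, 1 - (b : ℂ) * z ∈ slitPlane := by
    intro z hz
    rw [sub_eq_add_neg]
    apply mem_slitPlane_of_norm_lt_one
    rw [norm_neg, norm_mul, Complex.norm_of_nonneg hb]
    exact (mul_le_mul_of_nonneg_left (mem_closedBall_zero_iff.1 hz) hb).trans_lt hbR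
  have hd : DifferentiableOn ℂ (fun z => (1 - (b : ℂ) * z) ^ ((γ / 2 : ℝ) : ℂ))
      (closedBall 0 R) := by
    intro z hz
    exact ((differentiableAt_const _).sub
      (differentiableAt_id.const_mul _)).differentiableWithinAt.cpow
        (differentiableWithinAt_const _) (hslit z hz)
  have h := hw.integral_sq_le hr hrR hd
  have hpt : ∀ z ∈ closedBall (0 : ℂ) R,
      ‖(1 - (b : ℂ) * z) ^ ((γ / 2 : ℝ) : ℂ)‖ ^ 2 = ‖1 - (b : ℂ) * z‖ ^ γ := by
    intro z hz
    rw [Complex.norm_cpow_real, ← Real.rpow_natCast, ← Real.rpow_mul (norm_nonneg _)]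
    congr 1
    push_cast
    ring
  have hm : ∀ v : ℂ → ℂ, IsSchwarzMap r v → ∀ θ, v (circleMap 0 r θ) ∈ closedBall (0 : ℂ) R :=
    fun v hv θ => mem_closedBall_zero_iff.2 ((hv.norm_circleMap_le hr.le θ).trans hrR.le)
  simp only [hpt _ (hm w hw _), hpt _ (hm _ (isSchwarzMap_id r) _)] at h
  exact h

/-- Shrinking `b` slightly reaches the boundary case `b * r = 1`, in which `1 - b z` vanishes on the
circle. -/
theorem tendsto_integral_rpow (hr : 0 < r) (hw : IsSchwarzMap r w) (b : ℝ) {γ : ℝ} (hγ : 0 < γ) :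
    Tendsto (fun t : ℝ =>
      ∫ θ in (0 : ℝ)..(2 * Real.pi), ‖1 - ((t * b : ℝ) : ℂ) * w (circleMap 0 r θ)‖ ^ γ) (𝓝[<] 1)
      (𝓝 (∫ θ in (0 : ℝ)..(2 * Real.pi), ‖1 - (b : ℂ) * w (circleMap 0 r θ)‖ ^ γ)) := by
  have hc : Continuous fun x : ℝ × ℝ => w (circleMap 0 r x.2) :=
    (hw.continuous_comp_circleMap hr).comp continuous_snd
  have ht : Continuous fun x : ℝ × ℝ => ((x.1 * b : ℝ) : ℂ) := by fun_prop
  have hF : Continuous fun x : ℝ × ℝ => ‖1 - ((x.1 * b : ℝ) : ℂ) * w (circleMap 0 r x.2)‖ ^ γ :=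
    (continuous_const.sub (ht.mul hc)).norm.rpow_const fun _ => Or.inr hγ.le
  have hcont : Continuous fun t : ℝ =>
      ∫ θ in (0 : ℝ)..(2 * Real.pi), ‖1 - ((t * b : ℝ) : ℂ) * w (circleMap 0 r θ)‖ ^ γ :=
    intervalIntegral.continuous_parametric_intervalIntegral_of_continuous' hF 0 (2 * Real.pi)
  have h := (hcont.tendsto 1).mono_left (nhdsWithin_le_nhds (s := Set.Iio 1))
  rwa [one_mul] at h

theorem integral_rpow_le_of_mul_le_one (hr : 0 < r) (hw : IsSchwarzMap r w) {b : ℝ} (hb : 0 ≤ b)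
    (hbr : b * r ≤ 1) {γ : ℝ} (hγ : 0 < γ) :
    ∫ θ in (0 : ℝ)..(2 * Real.pi), ‖1 - (b : ℂ) * w (circleMap 0 r θ)‖ ^ γ
      ≤ ∫ θ in (0 : ℝ)..(2 * Real.pi), ‖1 - (b : ℂ) * circleMap 0 r θ‖ ^ γ := by
  refine le_of_tendsto_of_tendsto (hw.tendsto_integral_rpow hr b hγ)
    ((isSchwarzMap_id r).tendsto_integral_rpow hr b hγ) ?_
  filter_upwards [Ioo_mem_nhdsLT (zero_lt_one (α := ℝ))] with t ht
  refine hw.integral_rpow_le_of_mul_lt_one hr (mul_nonneg ht.1.le hb) ?_ γ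
  rw [mul_assoc]
  exact (mul_le_of_le_one_right ht.1.le hbr).trans_lt ht.2

/-- For `a r ≥ 1` the right side is nonnegative on the disk and zero on its boundary; this justifies
the reflection. -/
theorem sq_norm_sub_sub_sq_norm (a r : ℝ) (hr : r ≠ 0) (z : ℂ) :
    ‖((a * r : ℝ) : ℂ) - ((r⁻¹ : ℝ) : ℂ) * z‖ ^ 2 - ‖1 - (a : ℂ) * z‖ ^ 2
      = (a ^ 2 * r ^ 2 - 1) * (1 - ‖z‖ ^ 2 / r ^ 2) := by
  simp only [← Complex.normSq_eq_norm_sq, Complex.normSq_apply]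
  simp
  field_simp
  ring

/-- Littlewood's subordination inequality for the powers of `|1 - a z|`. -/
theorem integral_rpow_le (hr : 0 < r) (hw : IsSchwarzMap r w) {a : ℝ} (ha : 0 ≤ a)
    {γ : ℝ} (hγ : 0 < γ) :
    ∫ θ in (0 : ℝ)..(2 * Real.pi), ‖1 - (a : ℂ) * w (circleMap 0 r θ)‖ ^ γ
      ≤ ∫ θ in (0 : ℝ)..(2 * Real.pi), ‖1 - (a : ℂ) * circleMap 0 r θ‖ ^ γ := by
  rcases le_total (a * r) 1 with har | har
  · exact hw.integral_rpow_le_of_mul_le_one hr ha har hγ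
  have ha' : 0 < a := by
    by_contra h
    nlinarith
  have har0 : 0 < a * r := mul_pos ha' hr
  -- The reflection of the zero `1 / a` in the circle of radius `r` is `a r² = 1 / b`.
  set b : ℝ := (a * r ^ 2)⁻¹ with hbdef
  have hb : 0 ≤ b := by positivity
  have hbr : b * r ≤ 1 := by
    have : b * r = (a * r)⁻¹ := by rw [hbdef]; field_simp
    rw [this]
    exact inv_le_one_of_one_le₀ har
  have hfac : ∀ z : ℂ, ((a * r : ℝ) : ℂ) - ((r⁻¹ : ℝ) : ℂ) * z
      = ((a * r : ℝ) : ℂ) * (1 - (b : ℂ) * z) := by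
    intro z
    have h1 : (a : ℂ) ≠ 0 := by exact_mod_cast ha'.ne'
    have h2 : (r : ℂ) ≠ 0 := by exact_mod_cast hr.ne'
    rw [hbdef]
    push_cast
    field_simp
  have hnorm : ∀ z : ℂ, ‖((a * r : ℝ) : ℂ) - ((r⁻¹ : ℝ) : ℂ) * z‖ ^ γ
      = (a * r) ^ γ * ‖1 - (b : ℂ) * z‖ ^ γ := by
    intro z
    rw [hfac, norm_mul, Complex.norm_of_nonneg har0.le,
      Real.mul_rpow har0.le (norm_nonneg _)]
  have hle : ∀ z : ℂ, ‖z‖ ≤ r → ‖1 - (a : ℂ) * z‖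
      ≤ ‖((a * r : ℝ) : ℂ) - ((r⁻¹ : ℝ) : ℂ) * z‖ := by
    intro z hz
    have h := sq_norm_sub_sub_sq_norm a r hr.ne' z
    have h1 : 0 ≤ a ^ 2 * r ^ 2 - 1 := by nlinarith
    have h2 : 0 ≤ 1 - ‖z‖ ^ 2 / r ^ 2 := by
      rw [sub_nonneg, div_le_one (by positivity)]
      gcongr
    exact le_of_sq_le_sq (by nlinarith [mul_nonneg h1 h2]) (norm_nonneg _)
  have heq : ∀ z : ℂ, ‖z‖ = r → ‖((a * r : ℝ) : ℂ) - ((r⁻¹ : ℝ) : ℂ) * z‖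
      = ‖1 - (a : ℂ) * z‖ := by
    intro z hz
    have h := sq_norm_sub_sub_sq_norm a r hr.ne' z
    rw [hz, div_self (by positivity), sub_self, mul_zero, sub_eq_zero] at h
    exact (pow_left_inj₀ (norm_nonneg _) (norm_nonneg _) two_ne_zero).1 h
  have hI : ∀ t : ℝ, Continuous fun θ : ℝ => ‖1 - (t : ℂ) * w (circleMap 0 r θ)‖ ^ γ := fun t =>
    (continuous_const.sub (continuous_const.mul
      (hw.continuous_comp_circleMap hr))).norm.rpow_const fun _ => Or.inr hγ.le
  calc
    ∫ θ in (0 : ℝ)..(2 * Real.pi), ‖1 - (a : ℂ) * w (circleMap 0 r θ)‖ ^ γ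
      ≤ ∫ θ in (0 : ℝ)..(2 * Real.pi), (a * r) ^ γ * ‖1 - (b : ℂ) * w (circleMap 0 r θ)‖ ^ γ := by
        apply intervalIntegral.integral_mono_on Real.two_pi_pos.le
        · exact (hI a).intervalIntegrable _ _
        · exact (continuous_const.mul (hI b)).intervalIntegrable _ _
        · intro θ _
          rw [← hnorm]
          have := hle _ (hw.norm_circleMap_le hr.le θ)
          gcongr
    _ ≤ (a * r) ^ γ * ∫ θ in (0 : ℝ)..(2 * Real.pi), ‖1 - (b : ℂ) * circleMap 0 r θ‖ ^ γ := by
        rw [intervalIntegral.integral_const_mul]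
        have := hw.integral_rpow_le_of_mul_le_one hr hb hbr hγ
        gcongr
    _ = _ := by
        rw [← intervalIntegral.integral_const_mul]
        congr 1
        ext θ
        rw [← hnorm, heq _ (by rw [norm_circleMap_zero, abs_of_pos hr])]

end IsSchwarzMap

/-! ### Power series and the operators as coefficient multipliers -/

/-- `f` is the sum on the unit disk of the power series with the real coefficients `d`. -/
def IsSeries (d : ℕ → ℝ) (f : ℂ → ℂ) : Prop :=
  ∀ z ∈ unitDisk, HasSum (fun n : ℕ => (d n : ℂ) * z ^ n) (f z)

theorem hasSum_of_eq {a b : ℕ → ℂ} {s t : ℂ} (h : HasSum a s) (hab : ∀ n, a n = b n)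
    (hst : s = t) : HasSum b t := by
  obtain rfl : a = b := funext hab
  rwa [← hst]

theorem mem_unitDisk {z : ℂ} : z ∈ unitDisk ↔ ‖z‖ < 1 := mem_ball_zero_iff

theorem ofReal_mem_unitDisk {x : ℝ} (hx₀ : 0 ≤ x) (hx₁ : x < 1) : (x : ℂ) ∈ unitDisk := by
  rwa [mem_unitDisk, Complex.norm_of_nonneg hx₀]

namespace IsSeries

variable {d e : ℕ → ℝ} {f g : ℂ → ℂ}

theorem congr (hf : IsSeries d f) (hd : ∀ n, d n = e n) (hfg : ∀ z ∈ unitDisk, f z = g z) :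
    IsSeries e g := by
  intro z hz
  rw [← hfg z hz]
  simpa only [hd] using hf z hz

theorem add (hf : IsSeries d f) (hg : IsSeries e g) :
    IsSeries (fun n => d n + e n) (fun z => f z + g z) := by
  intro z hz
  simpa [add_mul] using (hf z hz).add (hg z hz)

theorem const_mul (hf : IsSeries d f) (a : ℝ) :
    IsSeries (fun n => a * d n) (fun z => (a : ℂ) * f z) := by
  intro z hz
  simpa [mul_assoc] using (hf z hz).mul_left (a : ℂ)

theorem hasSum_ofReal (hf : IsSeries d f) {x : ℝ} (hx₀ : 0 ≤ x) (hx₁ : x < 1) :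
    HasSum (fun n => d n * x ^ n) (f x).re := by
  have h := Complex.hasSum_re (hf x (ofReal_mem_unitDisk hx₀ hx₁))
  convert h using 2 with n
  rw [← Complex.ofReal_pow, ← Complex.ofReal_mul, Complex.ofReal_re]

theorem ofReal_re_eq (hf : IsSeries d f) {x : ℝ} (hx₀ : 0 ≤ x) (hx₁ : x < 1) :
    f x = ((f x).re : ℂ) := by
  have h := hf x (ofReal_mem_unitDisk hx₀ hx₁)
  have h2 := Complex.hasSum_ofReal.2 (hf.hasSum_ofReal hx₀ hx₁)
  push_cast at h2
  exact h.unique h2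

theorem summable_norm (hf : IsSeries d f) {x : ℝ} (hx₀ : 0 ≤ x) (hx₁ : x < 1) :
    Summable fun n => ‖d n‖ * x ^ n := by
  have h := (hf.hasSum_ofReal hx₀ hx₁).summable.norm
  simpa [abs_of_nonneg hx₀] using h

theorem eqOn_tsum (hf : IsSeries d f) :
    Set.EqOn f (fun z => ∑' n : ℕ, (d n : ℂ) * z ^ n) unitDisk :=
  fun z hz => (hf z hz).tsum_eq.symm

theorem norm_term_le {z : ℂ} {x : ℝ} (hz : ‖z‖ ≤ x) (n : ℕ) :
    ‖(d n : ℂ) * z ^ n‖ ≤ ‖d n‖ * x ^ n := by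
  rw [norm_mul, norm_pow, Complex.norm_real]
  gcongr

theorem hasSum_deriv (hf : IsSeries d f) {z : ℂ} (hz : z ∈ unitDisk) :
    HasSum (fun n : ℕ => deriv (fun w : ℂ => (d n : ℂ) * w ^ n) z) (deriv f z) := by
  obtain ⟨x, hzx, hx⟩ := exists_between (mem_unitDisk.1 hz)
  have h := Complex.hasSum_deriv_of_summable_norm (F := fun n (w : ℂ) => (d n : ℂ) * w ^ n)
    (hf.summable_norm ((norm_nonneg z).trans hzx.le) hx)
    (fun n => by fun_prop) isOpen_ball (fun n w hw => norm_term_le (mem_ball_zero_iff.1 hw).le n)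
    (mem_ball_zero_iff.2 hzx)
  refine hasSum_of_eq h (fun n => rfl) (Eq.symm ?_)
  exact (hf.eqOn_tsum.eventuallyEq_of_mem (isOpen_ball.mem_nhds hz)).deriv_eq

theorem differentiableOn (hf : IsSeries d f) : DifferentiableOn ℂ f unitDisk := by
  intro z hz
  obtain ⟨x, hzx, hx⟩ := exists_between (mem_unitDisk.1 hz)
  have h := Complex.differentiableOn_tsum_of_summable_norm
    (F := fun n (w : ℂ) => (d n : ℂ) * w ^ n)
    (hf.summable_norm ((norm_nonneg z).trans hzx.le) hx)
    (fun n => by fun_prop) isOpen_ball (fun n w hw => norm_term_le (mem_ball_zero_iff.1 hw).le n)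
  have h2 := (h z (mem_ball_zero_iff.2 hzx)).differentiableAt
    (isOpen_ball.mem_nhds (mem_ball_zero_iff.2 hzx))
  exact (h2.congr_of_eventuallyEq
    (hf.eqOn_tsum.eventuallyEq_of_mem (isOpen_ball.mem_nhds hz))).differentiableWithinAt

theorem mul_deriv (hf : IsSeries d f) :
    IsSeries (fun n => n * d n) (fun z => z * deriv f z) := by
  intro z hz
  refine hasSum_of_eq ((hf.hasSum_deriv hz).mul_left z) (fun n => ?_) rfl
  cases n with
  | zero => simp
  | succ n =>
    simp
    ring

theorem mul_jacksonDeriv (hf : IsSeries d f) {p q : ℝ} (hp : 0 < p) (hpq : p < q) (hq : q ≤ 1) :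
    IsSeries (fun n => bracket p q n * d n) (fun z => z * jacksonDeriv p q f z) := by
  intro z hz
  rcases eq_or_ne z 0 with rfl | hz0
  · refine hasSum_of_eq hasSum_zero (fun n => ?_) ?_
    -- For `n = 0` the bracket is an empty sum, so the constant term is killed.
    · cases n <;> simp [bracket]
    · simp
  have hmem : ∀ t : ℝ, 0 ≤ t → t ≤ 1 → (t : ℂ) * z ∈ unitDisk := by
    intro t ht₀ ht₁
    rw [mem_unitDisk, norm_mul, Complex.norm_of_nonneg ht₀]
    exact (mul_le_of_le_one_left (norm_nonneg z) ht₁).trans_lt (mem_unitDisk.1 hz)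
  have hne : (p : ℂ) - q ≠ 0 := sub_ne_zero.2 (by exact_mod_cast hpq.ne)
  have h := ((hf _ (hmem p hp.le (hpq.le.trans hq))).sub
    (hf _ (hmem q (hp.trans hpq).le hq))).div_const ((p : ℂ) - q)
  have hb : ∀ n, (bracket p q n : ℂ) * (p - q) = (p : ℂ) ^ n - (q : ℂ) ^ n := by
    intro n
    have h1 := geom_sum₂_mul q p n
    have h2 : bracket p q n * (q - p) = q ^ n - p ^ n := by
      rw [← h1, bracket]
      simp_rw [mul_comm]
    have h3 : bracket p q n * (p - q) = p ^ n - q ^ n := by linarith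
    exact_mod_cast h3
  refine hasSum_of_eq h (fun n => ?_) ?_
  · rw [div_eq_iff hne]
    push_cast
    rw [mul_pow, mul_pow]
    linear_combination -(d n : ℂ) * z ^ n * hb n
  · simp only [jacksonDeriv, if_neg hz0]
    field_simp

theorem exists_shift (hf : IsSeries d f) (hd : d 0 = 0) :
    ∃ g, IsSeries (fun n => d (n + 1)) g ∧ ∀ z ∈ unitDisk, f z = z * g z := by
  have hs : ∀ z ∈ unitDisk, HasSum (fun n : ℕ => z * ((d (n + 1) : ℂ) * z ^ n)) (f z) := by
    intro z hz
    have h := (hasSum_nat_add_iff' 1).2 (hf z hz)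
    simp only [Finset.range_one, Finset.sum_singleton, hd, ofReal_zero, zero_mul, sub_zero] at h
    exact hasSum_of_eq h (fun n => by ring) rfl
  have hg : IsSeries (fun n => d (n + 1)) (fun z => ∑' n : ℕ, (d (n + 1) : ℂ) * z ^ n) := by
    intro z hz
    apply Summable.hasSum
    -- Summability after division by `z` cannot be inherited at `z = 0`, where only one term
    -- survives.
    rcases eq_or_ne z 0 with rfl | hz0
    · refine summable_of_ne_finset_zero (s := {0}) fun n hn => ?_
      simp at hn
      simp [hn]
    · exact (summable_mul_left_iff hz0).1 (hs z hz).summable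
  exact ⟨_, hg, fun z hz => (hs z hz).unique ((hg z hz).mul_left z)⟩

theorem Psi {p q : ℝ} (hf : IsSeries d f) (hp : 0 < p) (hpq : p < q) (hq : q ≤ 1) (κ : ℕ) :
    IsSeries (fun n => bracket p q n ^ κ * d n) (Psi p q κ f) := by
  induction κ with
  | zero => exact hf.congr (fun n => by simp) fun z _ => rfl
  | succ κ ih =>
    exact (ih.mul_jacksonDeriv hp hpq hq).congr (fun n => by ring) fun z _ => rfl

theorem Upsilon {p q : ℝ} (hf : IsSeries d f) (hp : 0 < p) (hpq : p < q) (hq : q ≤ 1) (τ : ℝ)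
    (ξ κ : ℕ) :
    IsSeries (fun n => (1 + ((n : ℝ) - 1) * τ) ^ ξ * (bracket p q n ^ κ * d n))
      (Upsilon τ p q ξ κ f) := by
  induction ξ with
  | zero => exact (hf.Psi hp hpq hq κ).congr (fun n => by simp) fun z _ => rfl
  | succ ξ ih =>
    refine ((ih.const_mul (1 - τ)).add (ih.mul_deriv.const_mul τ)).congr
      (fun n => by ring) fun z _ => ?_
    simp [PQStarlike.Upsilon, mul_assoc]

end IsSeries

/-- The factors by which `denQ` multiplies the Taylor coefficients. -/
def denFactor (p q τ : ℝ) (ξ κ n : ℕ) : ℝ :=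
  bracket p q n ^ κ * (1 + (bracket p q n - 1) * τ) * (1 + ((n : ℝ) - 1) * τ) ^ ξ

theorem weight_eq_denFactor_mul (p q τ η : ℝ) (ξ κ n : ℕ) :
    weight p q ξ κ τ η n = denFactor p q τ ξ κ n * (n - η) := by
  rw [weight, denFactor]
  ring

theorem IsSeries.denQ {d : ℕ → ℝ} {f : ℂ → ℂ} {p q : ℝ} (hf : IsSeries d f) (hp : 0 < p)
    (hpq : p < q) (hq : q ≤ 1) (τ : ℝ) (ξ κ : ℕ) :
    IsSeries (fun n => denFactor p q τ ξ κ n * d n) (denQ p q τ ξ κ f) := by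
  refine (((hf.Upsilon hp hpq hq τ ξ κ).const_mul (1 - τ)).add
    ((hf.Upsilon hp hpq hq τ ξ (κ + 1)).const_mul τ)).congr (fun n => ?_) fun z _ => ?_
  · rw [denFactor]
    ring
  · simp [PQStarlike.denQ]

theorem IsSeries.numQ {d : ℕ → ℝ} {f : ℂ → ℂ} {p q : ℝ} (hf : IsSeries d f) (hp : 0 < p)
    (hpq : p < q) (hq : q ≤ 1) (τ : ℝ) (ξ κ : ℕ) :
    IsSeries (fun n => n * (denFactor p q τ ξ κ n * d n)) (numQ p q τ ξ κ f) := by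
  refine (((hf.Upsilon hp hpq hq τ ξ κ).mul_deriv.const_mul (1 - τ)).add
    ((hf.Upsilon hp hpq hq τ ξ (κ + 1)).mul_deriv.const_mul τ)).congr (fun n => ?_) fun z _ => ?_
  · rw [denFactor]
    ring
  · simp [PQStarlike.numQ, mul_assoc]

/-! ### Coefficient estimates -/

/-- A real power series `x + ⋯` without zeros in the punctured disk is positive on `(0, 1)`. -/
theorem IsSeries.re_pos {e : ℕ → ℝ} {D : ℂ → ℂ} (hD : IsSeries e D) (he₀ : e 0 = 0) (he₁ : e 1 = 1)
    (hne : ∀ z ∈ unitDisk, z ≠ 0 → D z ≠ 0) {x : ℝ} (hx₀ : 0 < x) (hx₁ : x < 1) :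
    0 < (D x).re := by
  obtain ⟨g, hg, hDg⟩ := hD.exists_shift he₀
  have hg0 : g 0 = 1 := by
    have h := hg 0 (by simp [mem_unitDisk])
    have h2 := hasSum_single (f := fun n : ℕ => ((e (n + 1) : ℝ) : ℂ) * (0 : ℂ) ^ n) 0
      (fun n hn => by simp [hn])
    simpa [he₁] using h.unique h2
  have hDx : (D x).re = x * (g x).re := by
    rw [hDg _ (ofReal_mem_unitDisk hx₀.le hx₁), Complex.re_ofReal_mul]
  rw [hDx]
  refine mul_pos hx₀ ?_
  by_contra hcon
  -- The quotient `g = D / z` is real on `[0, x]` with `g 0 = 1`, so a sign change would give a zero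
  -- of `D` in `(0, x]`.
  have hc : ContinuousOn (fun t : ℝ => (g t).re) (Set.Icc 0 x) := by
    refine Complex.continuous_re.comp_continuousOn (hg.differentiableOn.continuousOn.comp
      Complex.continuous_ofReal.continuousOn fun t ht => ?_)
    exact ofReal_mem_unitDisk ht.1 (ht.2.trans_lt hx₁)
  obtain ⟨t, ht, hgt⟩ := intermediate_value_Icc' hx₀.le hc
    (show (0 : ℝ) ∈ Set.Icc _ _ from ⟨not_lt.1 hcon, by simp [hg0]⟩)
  have ht1 : t < 1 := ht.2.trans_lt hx₁
  have ht0 : t ≠ 0 := by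
    rintro rfl
    simp [hg0] at hgt
  refine hne t (ofReal_mem_unitDisk ht.1 ht1) (by exact_mod_cast ht0) ?_
  have hgt' : (g t).re = 0 := hgt
  rw [hDg _ (ofReal_mem_unitDisk ht.1 ht1), hg.ofReal_re_eq ht.1 ht1, hgt']
  simp

/-- At real `x` the condition reads `N - η D > 0`, since `D > 0` there. All coefficients of `η D -
N` beyond the linear one are nonnegative, so its partial sums obey the bound, and finite sums pass
to `x → 1⁻` without any convergence at `1`. -/
theorem IsSeries.sum_mul_le {e : ℕ → ℝ} {D N : ℂ → ℂ} {η : ℝ} (hD : IsSeries e D)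
    (hN : IsSeries (fun n => n * e n) N) (he₀ : e 0 = 0) (he₁ : e 1 = 1)
    (he : ∀ n, e (n + 2) ≤ 0) (hη : η < 1)
    (hne : ∀ z ∈ unitDisk, z ≠ 0 → D z ≠ 0 ∧ η < (N z / D z).re) (M : ℕ) :
    ∑ n ∈ Finset.range M, ((n : ℝ) + 2 - η) * -e (n + 2) ≤ 1 - η := by
  have key : ∀ x : ℝ, 0 < x → x < 1 →
      ∑ n ∈ Finset.range M, ((n : ℝ) + 2 - η) * -e (n + 2) * x ^ (n + 2) ≤ (1 - η) * x := by
    intro x hx₀ hx₁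
    have hDpos := hD.re_pos he₀ he₁ (fun z hz hz0 => (hne z hz hz0).1) hx₀ hx₁
    have hlt := (hne x (ofReal_mem_unitDisk hx₀.le hx₁) (by exact_mod_cast hx₀.ne')).2
    rw [hN.ofReal_re_eq hx₀.le hx₁, hD.ofReal_re_eq hx₀.le hx₁, ← Complex.ofReal_div,
      Complex.ofReal_re, lt_div_iff₀ hDpos] at hlt
    have hsum := ((hD.hasSum_ofReal hx₀.le hx₁).mul_left η).sub (hN.hasSum_ofReal hx₀.le hx₁)
    have h2 := (hasSum_nat_add_iff' 2).2 hsum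
    simp only [Finset.sum_range_succ, Finset.range_zero, Finset.sum_empty, he₀, he₁] at h2
    have h3 := sum_le_hasSum (Finset.range M) (fun n _ => ?_) h2
    · calc
        _ = ∑ n ∈ Finset.range M, (η * (e (n + 2) * x ^ (n + 2))
              - ((n + 2 : ℕ) : ℝ) * e (n + 2) * x ^ (n + 2)) := by
            refine Finset.sum_congr rfl fun n _ => ?_
            push_cast
            ring
        _ ≤ _ := h3
        _ ≤ _ := by
            norm_num
            linarith
    · have : η * (e (n + 2) * x ^ (n + 2)) - ((n + 2 : ℕ) : ℝ) * e (n + 2) * x ^ (n + 2)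
          = ((n : ℝ) + 2 - η) * -e (n + 2) * x ^ (n + 2) := by
        push_cast
        ring
      rw [this]
      have h4 : 0 ≤ (n : ℝ) + 2 - η := by
        have : (0 : ℝ) ≤ n := n.cast_nonneg
        linarith
      have h5 := neg_nonneg.2 (he n)
      positivity
  have hl : Tendsto (fun x : ℝ =>
      ∑ n ∈ Finset.range M, ((n : ℝ) + 2 - η) * -e (n + 2) * x ^ (n + 2)) (𝓝[<] 1)
      (𝓝 (∑ n ∈ Finset.range M, ((n : ℝ) + 2 - η) * -e (n + 2) * 1 ^ (n + 2))) :=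
    ((by fun_prop : Continuous fun x : ℝ => ∑ n ∈ Finset.range M,
      ((n : ℝ) + 2 - η) * -e (n + 2) * x ^ (n + 2)).tendsto 1).mono_left nhdsWithin_le_nhds
  have hr : Tendsto (fun x : ℝ => (1 - η) * x) (𝓝[<] 1) (𝓝 ((1 - η) * 1)) :=
    ((by fun_prop : Continuous fun x : ℝ => (1 - η) * x).tendsto 1).mono_left nhdsWithin_le_nhds
  have h := le_of_tendsto_of_tendsto hl hr (by
    filter_upwards [Ioo_mem_nhdsLT (zero_lt_one (α := ℝ))] with x hx using key x hx.1 hx.2)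
  simpa using h

theorem bracket_pos {p q : ℝ} (hp : 0 < p) (hq : 0 < q) {n : ℕ} (hn : n ≠ 0) :
    0 < bracket p q n :=
  Finset.sum_pos (fun _ _ => by positivity) (Finset.nonempty_range_iff.2 hn)

theorem weight_two (p q τ η : ℝ) (ξ κ : ℕ) :
    weight p q ξ κ τ η 2
      = bracket p q 2 ^ κ * (2 - η) * (1 + (bracket p q 2 - 1) * τ) * (1 + τ) ^ ξ := by
  norm_num [weight]

/-- The values `c 0` and `c 1` are arbitrary, hence the cut-off. -/
theorem isSeries_sub_of_hasSum {φ : ℂ → ℂ} {c : ℕ → ℝ}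
    (h : ∀ z ∈ unitDisk, HasSum (fun n : ℕ => (c (n + 2) : ℂ) * z ^ (n + 2)) (z - φ z)) :
    IsSeries (fun n => if 2 ≤ n then c n else 0) (fun z => z - φ z) := by
  intro z hz
  refine (hasSum_nat_add_iff' 2).1 ?_
  refine hasSum_of_eq (h z hz) (fun n => by simp) ?_
  simp [Finset.sum_range_succ]

theorem isSeries_of_hasSum {φ : ℂ → ℂ} {c : ℕ → ℝ}
    (h : ∀ z ∈ unitDisk, HasSum (fun n : ℕ => (c (n + 2) : ℂ) * z ^ (n + 2)) (z - φ z)) :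
    IsSeries (fun n => (if n = 1 then 1 else 0) + -1 * (if 2 ≤ n then c n else 0)) φ := by
  have hid : IsSeries (fun n => if n = 1 then 1 else 0) (fun z => z) := by
    intro z _
    refine hasSum_of_eq (hasSum_ite_eq 1 z) (fun n => ?_) rfl
    split_ifs with hn <;> simp [hn]
  exact (hid.add ((isSeries_sub_of_hasSum h).const_mul (-1))).congr (fun _ => rfl)
    fun z _ => by simp

/-- The coefficient estimate for the class `𝒫`. -/
theorem sum_weight_mul_le {p q τ η : ℝ} {ξ κ : ℕ} (hp : 0 < p) (hpq : p < q) (hq : q ≤ 1)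
    (hη : η < 1) (hw : ∀ n, 0 < weight p q ξ κ τ η (n + 2)) {φ : ℂ → ℂ}
    (hφ : φ ∈ classQ p q ξ κ τ η) {c : ℕ → ℝ} (hc : ∀ n, 2 ≤ n → 0 ≤ c n)
    (h : ∀ z ∈ unitDisk, HasSum (fun n : ℕ => (c (n + 2) : ℂ) * z ^ (n + 2)) (z - φ z)) (M : ℕ) :
    ∑ n ∈ Finset.range M, weight p q ξ κ τ η (n + 2) * c (n + 2) ≤ 1 - η := by
  have hs := isSeries_of_hasSum h
  have hden : ∀ n, 0 < denFactor p q τ ξ κ (n + 2) := by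
    intro n
    have h1 := hw n
    rw [weight_eq_denFactor_mul] at h1
    refine pos_of_mul_pos_left h1 ?_
    push_cast
    have : (0 : ℝ) ≤ n := n.cast_nonneg
    linarith
  refine le_trans (le_of_eq (Finset.sum_congr rfl fun n _ => ?_))
    ((hs.denQ hp hpq hq τ ξ κ).sum_mul_le (hs.numQ hp hpq hq τ ξ κ) ?_ ?_ ?_ hη hφ.2 M)
  · rw [weight_eq_denFactor_mul]
    simp
    ring
  · simp
  -- The multiplier at `1` is `1`, which keeps the normalization.
  · simp [denFactor, bracket]
  · intro n
    have h1 := mul_nonneg (hden n).le (hc (n + 2) le_add_self)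
    simpa using h1

theorem sum_le_div_weight_two {p q τ η : ℝ} {ξ κ : ℕ}
    (hmono : MonotoneOn (weight p q ξ κ τ η) (Set.Ici 2)) (hw : 0 < weight p q ξ κ τ η 2)
    {c : ℕ → ℝ} (hc : ∀ n, 2 ≤ n → 0 ≤ c n) {M : ℕ}
    (h : ∑ n ∈ Finset.range M, weight p q ξ κ τ η (n + 2) * c (n + 2) ≤ 1 - η) :
    ∑ n ∈ Finset.range M, c (n + 2) ≤ (1 - η) / weight p q ξ κ τ η 2 := by
  rw [le_div_iff₀' hw, Finset.mul_sum]
  refine le_trans (Finset.sum_le_sum fun n _ => ?_) h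
  have h1 := hmono (Set.mem_Ici.2 le_rfl) (Set.mem_Ici.2 (le_add_self (a := 2) (b := n)))
    le_add_self
  have h2 := hc (n + 2) le_add_self
  gcongr

/-- If the sums of the coefficients `c_ν ≥ 0` are at most `a`, then
`z - ∑ c_ν z^ν = z (1 - a w(z))` with a Schwarz function `w`. -/
theorem exists_isSchwarzMap {φ : ℂ → ℂ} {c : ℕ → ℝ} {a : ℝ} (ha : 0 < a)
    (hc : ∀ n, 2 ≤ n → 0 ≤ c n) (hsum : ∀ M, ∑ n ∈ Finset.range M, c (n + 2) ≤ a)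
    (h : ∀ z ∈ unitDisk, HasSum (fun n : ℕ => (c (n + 2) : ℂ) * z ^ (n + 2)) (z - φ z))
    {r : ℝ} (hr₀ : 0 < r) (hr₁ : r < 1) :
    ∃ w, IsSchwarzMap r w ∧ ∀ z ∈ unitDisk, φ z = z * (1 - (a : ℂ) * w z) := by
  obtain ⟨g, hg, hφg⟩ := (isSeries_sub_of_hasSum h).exists_shift (by simp)
  obtain ⟨k, hk', hgk⟩ := hg.exists_shift (by simp)
  have hk : IsSeries (fun n => c (n + 2)) k := hk'.congr (fun n => by simp) fun _ _ => rfl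
  have ha' : (a : ℂ) ≠ 0 := by exact_mod_cast ha.ne'
  have hsub : closedBall (0 : ℂ) r ⊆ unitDisk := closedBall_subset_ball hr₁
  have hkle : ∀ z ∈ unitDisk, ‖k z‖ ≤ a := by
    intro z hz
    refine le_of_tendsto' (hk z hz).tendsto_sum_nat.norm fun M => ?_
    refine (norm_sum_le _ _).trans (le_trans (Finset.sum_le_sum fun n _ => ?_) (hsum M))
    rw [norm_mul, norm_pow, Complex.norm_real,
      Real.norm_of_nonneg (hc _ le_add_self)]
    exact mul_le_of_le_one_right (hc _ le_add_self)
      (pow_le_one₀ (norm_nonneg z) (mem_unitDisk.1 hz).le)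
  -- Here `z - φ z = z² k z`, and `|k| ≤ ∑ c_ν ≤ a`.
  refine ⟨fun z => z * (k z / a), ⟨?_, by simp, ?_⟩, ?_⟩
  · apply DifferentiableOn.diffContOnCl
    rw [closure_ball _ hr₀.ne']
    exact differentiableOn_id.mul ((hk.differentiableOn.mono hsub).div_const _)
  · intro z hz
    rw [norm_mul, norm_div, Complex.norm_of_nonneg ha.le, mem_sphere_zero_iff_norm.1 hz]
    exact mul_le_of_le_one_right hr₀.le
      ((div_le_one ha).2 (hkle z (hsub (sphere_subset_closedBall hz))))
  · intro z hz
    have h1 := hφg z hz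
    rw [hgk z hz] at h1
    field_simp
    linear_combination -h1

end PQStarlike

/-! ### The integral mean inequality -/

theorem mainTheorem2 (p q τ η : ℝ) (ξ κ : ℕ)
    (hp : 0 < p) (hpq : p < q) (hq : q ≤ 1)
    (hτ : 0 ≤ τ) (hη₀ : 0 ≤ η) (hη₁ : η < 1)
    (hpos : 0 < 1 + (PQStarlike.bracket p q 2 - 1) * τ)
    (hmono : MonotoneOn (PQStarlike.weight p q ξ κ τ η) (Set.Ici 2))
    (φ : ℂ → ℂ) (hφ : φ ∈ PQStarlike.classP p q ξ κ τ η)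
    (r γ : ℝ) (hr₀ : 0 < r) (hr₁ : r < 1) (hγ : 0 < γ) :
    ∫ θ in (0 : ℝ)..(2 * Real.pi),
        ‖φ ((r : ℂ) * Complex.exp (Complex.I * (θ : ℂ)))‖ ^ γ
      ≤ ∫ θ in (0 : ℝ)..(2 * Real.pi),
        ‖PQStarlike.extremal p q ξ κ τ η ((r : ℂ) * Complex.exp (Complex.I * (θ : ℂ)))‖ ^ γ := by
  obtain ⟨hQ, -, c, hc, hsum⟩ := hφ
  have hw2 : 0 < PQStarlike.weight p q ξ κ τ η 2 := by
    rw [PQStarlike.weight_two]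
    have h1 := PQStarlike.bracket_pos hp (hp.trans hpq) two_ne_zero
    have h2 : 0 < 2 - η := by linarith
    positivity
  -- Positivity is assumed only for the factor at `ν = 2`; monotonicity carries it to all later
  -- weights.
  have hw : ∀ n, 0 < PQStarlike.weight p q ξ κ τ η (n + 2) := fun n =>
    hw2.trans_le (hmono (Set.mem_Ici.2 le_rfl) (Set.mem_Ici.2 le_add_self) le_add_self)
  set a : ℝ := (1 - η) / PQStarlike.weight p q ξ κ τ η 2 with ha
  have ha0 : 0 < a := div_pos (by linarith) hw2
  obtain ⟨w, hwS, hφw⟩ := PQStarlike.exists_isSchwarzMap ha0 hc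
    (fun M => PQStarlike.sum_le_div_weight_two hmono hw2 hc
      (PQStarlike.sum_weight_mul_le hp hpq hq hη₁ hw hQ hc hsum M)) hsum hr₀ hr₁
  have hmap : ∀ θ : ℝ, (r : ℂ) * Complex.exp (Complex.I * (θ : ℂ)) = circleMap 0 r θ := by
    intro θ
    rw [circleMap_zero, mul_comm Complex.I]
  have hnorm : ∀ θ : ℝ, ‖circleMap 0 r θ‖ = r := fun θ => by
    rw [norm_circleMap_zero, abs_of_pos hr₀]
  have hleft : ∀ θ : ℝ, ‖φ (circleMap 0 r θ)‖ ^ γ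
      = r ^ γ * ‖1 - (a : ℂ) * w (circleMap 0 r θ)‖ ^ γ := by
    intro θ
    rw [hφw _ (PQStarlike.mem_unitDisk.2 (by rwa [hnorm])), norm_mul, hnorm,
      Real.mul_rpow hr₀.le (norm_nonneg _)]
  have hright : ∀ θ : ℝ, ‖PQStarlike.extremal p q ξ κ τ η (circleMap 0 r θ)‖ ^ γ
      = r ^ γ * ‖1 - (a : ℂ) * circleMap 0 r θ‖ ^ γ := by
    intro θ
    have h1 : PQStarlike.extremal p q ξ κ τ η (circleMap 0 r θ)
        = circleMap 0 r θ * (1 - (a : ℂ) * circleMap 0 r θ) := by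
      rw [PQStarlike.extremal, ← PQStarlike.weight_two, ← ha]
      ring
    rw [h1, norm_mul, hnorm, Real.mul_rpow hr₀.le (norm_nonneg _)]
  simp_rw [hmap, hleft, hright]
  rw [intervalIntegral.integral_const_mul, intervalIntegral.integral_const_mul]
  have hL := hwS.integral_rpow_le hr₀ ha0.le hγ
  gcongr
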